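/- Let $\alpha>0$, $\beta\in(0,1)$ and $\mathbb R_+=[0,\infty)$. A sup-measure on $\mathbb R_+$ is a map $m$ from the (relatively) open subsets of $\mathbb R_+$ to $[0,\infty]$ with $m(\emptyset)=0$ and $m(\bigcup_i G_i)=\sup_i m(G_i)$ for arbitrary families of open sets; it is extended to all sets by $m(A)=\inf\{m(G): G\supseteq A \text{ open}\}$. The space of sup-measures carries the sup-vague topology, in which $m_n\to m$ iff $\limsup_n m_n(K)\le m(K)$ for all compact $K$ and $\liminf_n m_n(G)\ge m(G)$ for all open $G$. A random sup-measure is a random element of this space with its Borel $\sigma$-algebra, defined up to null sets. Let $\{(\Gamma_\ell,x_\ell,\mathcal N_\ell)\}_{\ell\in\mathbb N}$ be a measurable enumeration of the points of a Poisson point process with intensity $$d\gamma\times\Gamma(1-\beta)^{-1}\beta x^{-\beta-1}\,dx\times d\widetilde{\mathbb P},$$ where $\gamma,x$ range over $\mathbb R_+$ and $\widetilde{\mathbb P}$ is the law of a Poisson random measure on $\mathbb R$ with Lebesgue intensity. Write $\mathcal N_\ell(t)=\mathcal N_\ell([0,t])$, $t\ge0$, for the associated counting processes, and for open $G\subset\mathbb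 R_+$ set $$\mathcal M^*_{\alpha,\beta}(G)=\sup_{\ell\in\mathbb N}\Gamma_\ell^{-1/\alpha}\,\mathbf 1\{\text{the first time } t \text{ with } \mathcal N_\ell(t)=1 \text{ lies in } x_\ell G\},\qquad x_\ell G=\{x_\ell y:y\in G\}.$$ Let $\{(\Gamma'_\ell,U_\ell)\}_{\ell\in\mathbb N}$ be a measurable enumeration of the points of a Poisson point process on $\mathbb R_+\times\mathbb R$ with intensity $d\gamma\,du$, and let $\mathcal M_\alpha(G)=\sup_{\ell}(\Gamma'_\ell)^{-1/\alpha}\mathbf 1\{U_\ell\in G\}$ be the independently scattered $\alpha$-Fréchet random sup-measure. Let $T_\beta(G)=\{t^\beta:t\in G\}$. Then $$\mathcal M^*_{\alpha,\beta}\stackrel{d}{=}\mathcal M_\alpha\circ T_\beta$$ as random sup-measures on $\mathbb R_+$. -/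

import Mathlib

open MeasureTheory ProbabilityTheory TopologicalSpace Set
open scoped NNReal ENNReal

noncomputable section

/-! ### Sup-measures and the sup-vague topology -/

/-- A sup-measure on `E`: a `[0, ∞]`-valued function of open sets that vanishes at the empty set
and turns arbitrary unions into suprema. -/
structure SupMeasure (E : Type*) [TopologicalSpace E] where
  toFun : Opens E → ℝ≥0∞
  map_empty : toFun ⊥ = 0
  map_sUnion : ∀ S : Set (Opens E), toFun (sSup S) = ⨆ G ∈ S, toFun G

namespace SupMeasure

variable {E : Type*} [TopologicalSpace E]

/-- The canonical extension of a sup-measure to all subsets of `E`. -/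
def ext (m : SupMeasure E) (A : Set E) : ℝ≥0∞ :=
  ⨅ (G : Opens E) (_ : A ⊆ G), m.toFun G

/-- The sup-vague topology, generated by the sets `{m | m(K) < c}` with `K` compact and
`{m | c < m(G)}` with `G` open, so that `mₙ → m` if and only if `limsup mₙ(K) ≤ m(K)` for all
compact `K` and `liminf mₙ(G) ≥ m(G)` for all open `G`. -/
instance supVagueTopology : TopologicalSpace (SupMeasure E) :=
  TopologicalSpace.generateFrom
    ({V | ∃ (K : Set E) (c : ℝ≥0∞), IsCompact K ∧ V = {m | m.ext K < c}} ∪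
      {V | ∃ (G : Opens E) (c : ℝ≥0∞), V = {m | c < m.toFun G}})

/-- The Borel σ-algebra of the sup-vague topology. -/
instance : MeasurableSpace (SupMeasure E) := borel _

instance : BorelSpace (SupMeasure E) := ⟨rfl⟩

/-- The sup-measure `G ↦ sup_ℓ Γ_ℓ ^ (-1/α) 1{R_ℓ ∩ G ≠ ∅}`. -/
def ofPoints (α : ℝ) (Γ : ℕ → ℝ≥0) (R : ℕ → Set E) : SupMeasure E where
  toFun G := ⨆ ℓ : ℕ, ⨆ _ : (R ℓ ∩ (G : Set E)).Nonempty, ((Γ ℓ : ℝ≥0∞) ^ (1 / α))⁻¹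
  map_empty := by simp
  map_sUnion S := by
    apply le_antisymm
    · refine iSup_le fun ℓ => iSup_le fun h => ?_
      obtain ⟨t, htR, htG⟩ := h
      obtain ⟨G, hG, htG⟩ := Opens.mem_sSup.1 htG
      exact le_iSup₂_of_le G hG (le_iSup₂_of_le ℓ ⟨t, htR, htG⟩ le_rfl)
    · refine iSup₂_le fun G hG => iSup_le fun ℓ => iSup_le fun h => ?_
      obtain ⟨t, htR, htG⟩ := h
      exact le_iSup₂_of_le ℓ ⟨t, htR, Opens.mem_sSup.2 ⟨G, hG, htG⟩⟩ le_rfl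

/-- The composition `(m ∘ T)(G) = m(T(G))`, where `T(G) = {T t : t ∈ G}`. -/
def comp (m : SupMeasure E) (T : E ≃ₜ E) : SupMeasure E where
  toFun G := m.toFun ⟨T '' G, T.isOpenMap _ G.isOpen⟩
  map_empty := by
    rw [← m.map_empty]
    congr 1
    ext t
    simp
  map_sUnion S := by
    have h : (⟨T '' ((sSup S : Opens E) : Set E), T.isOpenMap _ (sSup S : Opens E).isOpen⟩ :
        Opens E) =
        sSup ((fun G : Opens E => (⟨T '' (G : Set E), T.isOpenMap _ G.isOpen⟩ : Opens E)) '' S) := by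
      apply Opens.ext
      simp only [Opens.coe_mk, Opens.coe_sSup, image_iUnion, biUnion_image]
    rw [h, m.map_sUnion, iSup_image]

end SupMeasure

/-! ### Poisson random measures -/

section Poisson

variable {Ω X : Type*} [MeasurableSpace Ω] [MeasurableSpace X]

/-- `N` is, under `P`, a Poisson random measure on `X` with intensity `μ`: its value on a
measurable set of finite `μ`-measure is Poisson distributed with mean the `μ`-measure of that set,
and its values on disjoint measurable sets are independent. -/
structure IsPoissonRandomMeasure (N : Ω → Measure X) (μ : Measure X) (P : Measure Ω) : Prop where
  measurable : Measurable N
  poisson : ∀ B : Set X, MeasurableSet B → μ B ≠ ∞ →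
    P.map (fun ω => N ω B) =
      (poissonMeasure (μ B).toNNReal).map (fun k : ℕ => (k : ℝ≥0∞))
  indep : ∀ (n : ℕ) (B : Fin n → Set X), (∀ i, MeasurableSet (B i)) →
    Pairwise (fun i j => Disjoint (B i) (B j)) → iIndepFun (fun i ω => N ω (B i)) P

/-- `ξ₀, ξ₁, …` is a measurable enumeration of the points of a Poisson point process on `X` with
intensity `μ`. -/
structure IsPoissonEnumeration (ξ : ℕ → Ω → X) (μ : Measure X) (P : Measure Ω) : Prop where
  measurable : ∀ ℓ, Measurable (ξ ℓ)
  poisson : IsPoissonRandomMeasure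
    (fun ω => Measure.sum fun ℓ => Measure.dirac (ξ ℓ ω)) μ P

end Poisson

/-! ### The two random sup-measures on `ℝ₊` -/

/-- The map `t ↦ t ^ β` of `ℝ₊` onto itself, for `β > 0`. -/
def powTime (β : ℝ) (hβ : 0 < β) : ℝ≥0 ≃ₜ ℝ≥0 :=
  (NNReal.orderIsoRpow β hβ).toHomeomorph

/-- `M_α(G) = sup_ℓ Γ_ℓ ^ (-1/α) 1{U_ℓ ∈ G}` for `G ⊆ ℝ₊`, as a function of the points
`(Γ_ℓ, U_ℓ)` in `ℝ₊ × ℝ`. -/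
def scatteredSupMeasure (α : ℝ) (p : ℕ → ℝ≥0 × ℝ) : SupMeasure ℝ≥0 :=
  SupMeasure.ofPoints α (fun ℓ => (p ℓ).1) (fun ℓ => {t : ℝ≥0 | (t : ℝ) = (p ℓ).2})

/-- The counting process `N(t) = N([0, t])`. -/
def countingProcess (N : Measure ℝ) (t : ℝ≥0) : ℝ≥0∞ := N (Icc 0 (t : ℝ))

/-- The set of all `t` such that `x t` is the first time at which the counting process of `N`
equals `1`; it meets `A` if and only if this first time lies in the scaled set `x A`. -/
def firstHitSet (x : ℝ≥0) (N : Measure ℝ) : Set ℝ≥0 :=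
  {t | IsLeast {s : ℝ≥0 | countingProcess N s = 1} (x * t)}

/-- `M*_{α,β}(G) = sup_ℓ Γ_ℓ ^ (-1/α) 1{N_ℓ first hits 1 in x_ℓ G}` for `G ⊆ ℝ₊`, as a function of
the points `(Γ_ℓ, x_ℓ, N_ℓ)`. -/
def firstHitSupMeasure (α : ℝ) (p : ℕ → ℝ≥0 × ℝ≥0 × Measure ℝ) : SupMeasure ℝ≥0 :=
  SupMeasure.ofPoints α (fun ℓ => (p ℓ).1) (fun ℓ => firstHitSet (p ℓ).2.1 (p ℓ).2.2)

/-- Lebesgue measure on `ℝ₊ = [0, ∞)`. -/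
def halfLineLebesgue : Measure ℝ≥0 :=
  (volume : Measure ℝ).comap (fun t : ℝ≥0 => (t : ℝ))

/-- The measure `Γ(1 - β)⁻¹ β x ^ (-β - 1) dx` on `ℝ₊`. -/
def scaleIntensity (β : ℝ) : Measure ℝ≥0 :=
  halfLineLebesgue.withDensity fun x =>
    ENNReal.ofReal ((Real.Gamma (1 - β))⁻¹ * β * (x : ℝ) ^ (-β - 1))

end

/-! ### The Borel σ-algebra of the sup-vague topology -/

/-! Both random sup-measures have the form `G ↦ sup Γ ^ (-1/α)` over the points of a Poisson process
whose location lies in `G`. A joint bound at finitely many open sets says that no point falls in a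
certain set of pairs (Γ, location). The probability of such a void event depends only on the
intensity of the set, so it suffices that the pairs have the same intensity in both models
(`SupMeasure.identDistrib_ofMarks`).

In the first model the location is τ/x, where τ is the first arrival time of a unit-rate Poisson
process, an Exp(1) variable. Since τ/x ≤ t means x ≥ τ/t, the x-intensity of this event is Γ(1-β)⁻¹
t^β τ^(-β). The identity E τ^(-β) = Γ(1-β) then gives mass t^β to `[0, t]`. In the second model the
location is U^(1/β) for U ≥ 0, and again `[0, t]` has mass t^β (`map_firstHit_div_eq`).

Two technical facts remain. Laws on the sup-vague Borel σ-algebra are determined by evaluations at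
open sets (`SupMeasure.measure_ext`). Moreover, the time at which the count equals exactly 1 almost
surely exists and is τ, because the Poisson measure is locally finite and has no double points
(`ae_firstHitSupMeasure_eq`). -/

/-- A second countable locally compact regular space has a countable family of relatively compact
open sets that separates compact sets from their neighbourhoods. -/
theorem exists_countable_opens_between (E : Type*) [TopologicalSpace E] [SecondCountableTopology E]
    [LocallyCompactSpace E] [RegularSpace E] :
    ∃ A : Set (Opens E), A.Countable ∧ (∀ F ∈ A, IsCompact (closure (F : Set E))) ∧
      ∀ (K : Set E) (G : Opens E), IsCompact K → K ⊆ G →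
        ∃ F ∈ A, K ⊆ F ∧ closure (F : Set E) ⊆ G := by
  -- Finite unions of basis sets form a countable family, and compactness fits one between `K` and a
  -- relatively compact neighbourhood.
  let C : Set (Set E) := (fun s : Set (Set E) => ⋃₀ s) '' {s | s.Finite ∧ s ⊆ countableBasis E}
  have hC : C.Countable :=
    (countable_ofPred_finite_subset (countable_countableBasis E)).image _
  refine ⟨{F : Opens E | (F : Set E) ∈ C ∧ IsCompact (closure (F : Set E))}, ?_,
    fun F hF => hF.2, ?_⟩
  · exact (hC.preimage (f := ((↑) : Opens E → Set E)) SetLike.coe_injective).mono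
      fun F hF => hF.1
  · intro K G hK hKG
    obtain ⟨V, hV, hKV, hVG, hVc⟩ :=
      exists_open_between_and_isCompact_closure hK G.isOpen hKG
    obtain ⟨T, hTb, hTV⟩ := (isBasis_countableBasis E).open_eq_sUnion hV
    obtain ⟨t, htT, htf, hKt⟩ := hK.elim_finite_subcover_image (b := T) (c := id)
      (fun s hs => isOpen_of_mem_countableBasis (hTb hs))
      (by simpa [← sUnion_eq_biUnion, ← hTV] using hKV)
    have htV : ⋃₀ t ⊆ V := hTV ▸ sUnion_subset_sUnion htT
    refine ⟨⟨⋃₀ t, isOpen_sUnion fun s hs => isOpen_of_mem_countableBasis (hTb (htT hs))⟩,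
      ⟨⟨t, ⟨htf, htT.trans hTb⟩, rfl⟩, hVc.of_isClosed_subset isClosed_closure (closure_mono htV)⟩,
      ?_, (closure_mono htV).trans hVG⟩
    simpa [sUnion_eq_biUnion] using hKt

namespace SupMeasure

variable {E : Type*} [TopologicalSpace E]

theorem mono (m : SupMeasure E) {G H : Opens E} (h : G ≤ H) : m.toFun G ≤ m.toFun H := by
  have := m.map_sUnion {G, H}
  rw [sSup_pair, sup_eq_right.2 h] at this
  rw [this]
  exact le_iSup₂_of_le G (by simp) le_rfl

theorem ext_lt_iff {m : SupMeasure E} {K : Set E} {c : ℝ≥0∞} :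
    m.ext K < c ↔ ∃ G : Opens E, K ⊆ G ∧ m.toFun G < c := by
  simp [SupMeasure.ext, iInf_lt_iff]

theorem lt_toFun_iff {A : Set (Opens E)}
    (hA : ∀ (K : Set E) (G : Opens E), IsCompact K → K ⊆ G →
      ∃ F ∈ A, K ⊆ F ∧ closure (F : Set E) ⊆ G)
    {m : SupMeasure E} {G : Opens E} {c : ℝ≥0∞} :
    c < m.toFun G ↔ ∃ F ∈ A, closure (F : Set E) ⊆ G ∧ c < m.toFun F := by
  constructor
  · intro h
    -- Singletons are compact, so the separation property exhausts `G` by members of `A` with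
    -- closure inside `G`.
    have hG : G = sSup {F ∈ A | closure (F : Set E) ⊆ G} := by
      apply le_antisymm
      · intro x hx
        obtain ⟨F, hF, hxF, hFG⟩ := hA {x} G isCompact_singleton (by simpa using hx)
        exact Opens.mem_sSup.2 ⟨F, ⟨hF, hFG⟩, by simpa using hxF⟩
      · exact sSup_le fun F hF => subset_closure.trans hF.2
    rw [hG, m.map_sUnion] at h
    simpa [lt_iSup_iff, and_assoc] using h
  · rintro ⟨F, -, hFG, h⟩
    exact h.trans_le (m.mono (subset_closure.trans hFG))

/-- The sup-vague topology has a countable subbasis. -/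
theorem exists_countable_subbasis (E : Type*) [TopologicalSpace E] [SecondCountableTopology E]
    [LocallyCompactSpace E] [RegularSpace E] :
    ∃ S : Set (Set (SupMeasure E)), S.Countable ∧
      S ⊆ {V | ∃ (K : Set E) (c : ℝ≥0∞), IsCompact K ∧ V = {m | m.ext K < c}} ∪
        {V | ∃ (G : Opens E) (c : ℝ≥0∞), V = {m | c < m.toFun G}} ∧
      supVagueTopology = generateFrom S := by
  obtain ⟨A, hAc, hAk, hA⟩ := exists_countable_opens_between E
  obtain ⟨D, hDc, hD⟩ := exists_countable_dense ℝ≥0∞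
  let S₁ : Set (Set (SupMeasure E)) :=
    (fun p : Opens E × ℝ≥0∞ => {m | m.ext (closure (p.1 : Set E)) < p.2}) '' (A ×ˢ D)
  let S₂ : Set (Set (SupMeasure E)) :=
    (fun p : Opens E × ℝ≥0∞ => {m | p.2 < m.toFun p.1}) '' (A ×ˢ D)
  have hsub : S₁ ∪ S₂ ⊆ {V | ∃ (K : Set E) (c : ℝ≥0∞), IsCompact K ∧ V = {m | m.ext K < c}} ∪
        {V | ∃ (G : Opens E) (c : ℝ≥0∞), V = {m | c < m.toFun G}} := by
    rintro V (⟨⟨F, q⟩, ⟨hF, -⟩, rfl⟩ | ⟨⟨F, q⟩, ⟨hF, -⟩, rfl⟩)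
    · exact Or.inl ⟨_, q, hAk F hF, rfl⟩
    · exact Or.inr ⟨F, q, rfl⟩
  refine ⟨S₁ ∪ S₂, ((hAc.prod hDc).image _).union ((hAc.prod hDc).image _), hsub,
    le_antisymm (generateFrom_anti hsub) (le_generateFrom ?_)⟩
  rintro V (⟨K, c, hK, rfl⟩ | ⟨G, c, rfl⟩)
  -- If m(G) < c with `K ⊆ G`, then some `F ∈ A` satisfies `K ⊆ F` and `closure F ⊆ G`, and some `q
  -- ∈ D` lies between m(G) and `c`.
  · have : {m : SupMeasure E | m.ext K < c} =
        ⋃ p ∈ {p : Opens E × ℝ≥0∞ | p ∈ A ×ˢ D ∧ K ⊆ p.1 ∧ p.2 ≤ c},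
          {m : SupMeasure E | m.ext (closure (p.1 : Set E)) < p.2} := by
      ext m
      simp only [mem_ofPred_eq, mem_iUnion, exists_prop, Prod.exists, mem_prod]
      constructor
      · intro h
        obtain ⟨G, hKG, hG⟩ := ext_lt_iff.1 h
        obtain ⟨F, hF, hKF, hFG⟩ := hA K G hK hKG
        obtain ⟨q, hq, h1, h2⟩ := hD.exists_between hG
        exact ⟨F, q, ⟨⟨hF, hq⟩, hKF, h2.le⟩, ext_lt_iff.2 ⟨G, hFG, h1⟩⟩
      · rintro ⟨F, q, ⟨-, hKF, hq⟩, h⟩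
        obtain ⟨G, hFG, hG⟩ := ext_lt_iff.1 h
        exact ext_lt_iff.2 ⟨G, (hKF.trans subset_closure).trans hFG, hG.trans_le hq⟩
    rw [this]
    exact @isOpen_biUnion _ _ (generateFrom (S₁ ∪ S₂)) _ _ fun p hp =>
      isOpen_generateFrom_of_mem (Or.inl ⟨p, hp.1, rfl⟩)
  · have : {m : SupMeasure E | c < m.toFun G} =
        ⋃ p ∈ {p : Opens E × ℝ≥0∞ | p ∈ A ×ˢ D ∧ closure (p.1 : Set E) ⊆ G ∧ c ≤ p.2},
          {m : SupMeasure E | p.2 < m.toFun p.1} := by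
      ext m
      simp only [mem_ofPred_eq, mem_iUnion, exists_prop, Prod.exists, mem_prod]
      constructor
      · intro h
        obtain ⟨F, hF, hFG, h⟩ := (lt_toFun_iff hA).1 h
        obtain ⟨q, hq, h1, h2⟩ := hD.exists_between h
        exact ⟨F, q, ⟨⟨hF, hq⟩, hFG, h1.le⟩, h2⟩
      · rintro ⟨F, q, ⟨⟨hF, -⟩, hFG, hq⟩, h⟩
        exact (lt_toFun_iff hA).2 ⟨F, hF, hFG, hq.trans_lt h⟩
    rw [this]
    exact @isOpen_biUnion _ _ (generateFrom (S₁ ∪ S₂)) _ _ fun p hp =>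
      isOpen_generateFrom_of_mem (Or.inr ⟨p, hp.1, rfl⟩)

/-- The Borel σ-algebra of the sup-vague topology is generated by the evaluations at open sets. -/
theorem borel_eq_generateFrom_toFun_le (E : Type*) [TopologicalSpace E]
    [SecondCountableTopology E] [LocallyCompactSpace E] [RegularSpace E] :
    borel (SupMeasure E) = MeasurableSpace.generateFrom
      {V | ∃ (G : Opens E) (c : ℝ≥0∞), V = {m | m.toFun G ≤ c}} := by
  obtain ⟨S, hSc, hS, htop⟩ := exists_countable_subbasis E
  obtain ⟨A, hAc, -, hA⟩ := exists_countable_opens_between E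
  have : SecondCountableTopology (SupMeasure E) := ⟨S, hSc, htop⟩
  rw [borel_eq_generateFrom_of_subbasis htop]
  apply le_antisymm
  · refine MeasurableSpace.generateFrom_le fun V hV => ?_
    have hm : ∀ G : Opens E, @Measurable _ _ (MeasurableSpace.generateFrom
        {V | ∃ (G : Opens E) (c : ℝ≥0∞), V = {m : SupMeasure E | m.toFun G ≤ c}}) _
        fun m : SupMeasure E => m.toFun G := fun G => by
      let _ := MeasurableSpace.generateFrom
        {V | ∃ (G : Opens E) (c : ℝ≥0∞), V = {m : SupMeasure E | m.toFun G ≤ c}}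
      exact measurable_of_Iic fun c => MeasurableSpace.measurableSet_generateFrom ⟨G, c, rfl⟩
    rcases hS hV with ⟨K, c, hK, rfl⟩ | ⟨G, c, rfl⟩
    -- Countability of `A` turns the infimum over all open neighbourhoods of `K` into a countable
    -- one.
    · have : {m : SupMeasure E | m.ext K < c} =
          ⋃ F ∈ {F ∈ A | K ⊆ F}, {m : SupMeasure E | m.toFun F < c} := by
        ext m
        simp only [mem_ofPred_eq, mem_iUnion, exists_prop]
        rw [ext_lt_iff]
        constructor
        · rintro ⟨G, hKG, hG⟩
          obtain ⟨F, hF, hKF, hFG⟩ := hA K G hK hKG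
          exact ⟨F, ⟨hF, hKF⟩, (m.mono (subset_closure.trans hFG)).trans_lt hG⟩
        · rintro ⟨F, ⟨-, hKF⟩, h⟩
          exact ⟨F, hKF, h⟩
      rw [this]
      exact @MeasurableSet.biUnion _ _ (_) _ _ (hAc.mono (sep_subset _ _)) fun F _ =>
        hm F measurableSet_Iio
    · exact hm G measurableSet_Ioi
  · refine MeasurableSpace.generateFrom_le ?_
    rintro _ ⟨G, c, rfl⟩
    rw [← borel_eq_generateFrom_of_subbasis htop]
    have : IsClosed {m : SupMeasure E | m.toFun G ≤ c} := by
      rw [← isOpen_compl_iff]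
      have h : {m : SupMeasure E | m.toFun G ≤ c}ᶜ = {m | c < m.toFun G} := by
        ext m; simp
      rw [h]
      exact isOpen_generateFrom_of_mem (Or.inr ⟨G, c, rfl⟩)
    rw [← BorelSpace.measurable_eq (α := SupMeasure E)]
    exact this.measurableSet

variable {Ω : Type*} [MeasurableSpace Ω]

theorem measurable_of_toFun [SecondCountableTopology E] [LocallyCompactSpace E] [RegularSpace E]
    {f : Ω → SupMeasure E} (hf : ∀ G : Opens E, Measurable fun ω => (f ω).toFun G) :
    Measurable f := by
  have h := borel_eq_generateFrom_toFun_le E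
  rw [← BorelSpace.measurable_eq (α := SupMeasure E)] at h
  rw [h]
  refine measurable_generateFrom ?_
  rintro _ ⟨G, c, rfl⟩
  exact hf G measurableSet_Iic

theorem measurableSet_forall_toFun_le [SecondCountableTopology E] [LocallyCompactSpace E]
    [RegularSpace E] (s : Finset (Opens E × ℝ≥0∞)) :
    MeasurableSet {m : SupMeasure E | ∀ p ∈ s, m.toFun p.1 ≤ p.2} := by
  have hb := borel_eq_generateFrom_toFun_le E
  rw [← BorelSpace.measurable_eq (α := SupMeasure E)] at hb
  have : {m : SupMeasure E | ∀ p ∈ s, m.toFun p.1 ≤ p.2} =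
      ⋂ p ∈ s, {m | m.toFun p.1 ≤ p.2} := by
    ext m; simp
  rw [this]
  refine s.measurableSet_biInter fun p _ => ?_
  rw [hb]
  exact MeasurableSpace.measurableSet_generateFrom ⟨p.1, p.2, rfl⟩

/-- Two laws of random sup-measures agree if they have the same finite-dimensional distribution
functions. -/
theorem measure_ext [SecondCountableTopology E] [LocallyCompactSpace E] [RegularSpace E]
    {μ ν : Measure (SupMeasure E)} [IsProbabilityMeasure μ] [IsProbabilityMeasure ν]
    (h : ∀ s : Finset (Opens E × ℝ≥0∞),
      μ {m | ∀ p ∈ s, m.toFun p.1 ≤ p.2} = ν {m | ∀ p ∈ s, m.toFun p.1 ≤ p.2}) : μ = ν := by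
  classical
  let C : Set (Set (SupMeasure E)) :=
    range fun s : Finset (Opens E × ℝ≥0∞) => {m | ∀ p ∈ s, m.toFun p.1 ≤ p.2}
  have hb := borel_eq_generateFrom_toFun_le E
  rw [← BorelSpace.measurable_eq (α := SupMeasure E)] at hb
  refine ext_of_generate_finite C ?_ ?_ ?_ (by simp)
  · apply le_antisymm
    · rw [hb]
      refine MeasurableSpace.generateFrom_mono ?_
      rintro _ ⟨G, c, rfl⟩
      exact ⟨{(G, c)}, by simp⟩
    · refine MeasurableSpace.generateFrom_le ?_
      rintro _ ⟨s, rfl⟩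
      exact measurableSet_forall_toFun_le s
  -- Indexing the events by finite sets of constraints makes them a π-system: intersecting events
  -- means uniting constraints.
  · rintro _ ⟨s, rfl⟩ _ ⟨t, rfl⟩ -
    refine ⟨s ∪ t, ?_⟩
    ext m
    simp only [Finset.mem_union, mem_ofPred_eq, mem_inter_iff]
    grind
  · rintro _ ⟨s, rfl⟩
    exact h s

end SupMeasure

/-! ### Void probabilities of Poisson random measures -/

namespace IsPoissonRandomMeasure

variable {Ω X : Type*} [MeasurableSpace Ω] [MeasurableSpace X]
  {N : Ω → Measure X} {μ : Measure X} {P : Measure Ω} {B : Set X}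

theorem measure_preimage (h : IsPoissonRandomMeasure N μ P) (hB : MeasurableSet B) (hμ : μ B ≠ ∞)
    {s : Set ℝ≥0∞} (hs : MeasurableSet s) :
    P {ω | N ω B ∈ s} = poissonMeasure (μ B).toNNReal {k : ℕ | (k : ℝ≥0∞) ∈ s} := by
  have hm : Measurable fun ω => N ω B := (Measure.measurable_coe hB).comp h.measurable
  have := h.poisson B hB hμ
  calc P {ω | N ω B ∈ s} = P.map (fun ω => N ω B) s := (Measure.map_apply hm hs).symm
    _ = _ := by
      rw [this, Measure.map_apply .of_discrete hs]
      rfl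

theorem measure_eq_zero_of_ne_top (h : IsPoissonRandomMeasure N μ P) (hB : MeasurableSet B)
    (hμ : μ B ≠ ∞) : P {ω | N ω B = 0} = ENNReal.ofReal (Real.exp (-(μ B).toReal)) := by
  have := h.measure_preimage hB hμ (measurableSet_singleton 0)
  simp only [mem_singleton_iff, Nat.cast_eq_zero, ofPred_eq_eq_singleton] at this
  rw [this, poissonMeasure_singleton]
  simp [ENNReal.coe_toNNReal_eq_toReal]

/-- Exhausting `B` by sets of finite intensity bounds the probability by `exp (-μ (S n))`, which
tends to 0. -/
theorem measure_eq_zero_of_eq_top [SigmaFinite μ] (h : IsPoissonRandomMeasure N μ P)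
    (hB : MeasurableSet B) (hμ : μ B = ∞) : P {ω | N ω B = 0} = 0 := by
  let S := fun n => B ∩ spanningSets μ n
  have hS : ∀ n, MeasurableSet (S n) := fun n => hB.inter (measurableSet_spanningSets μ n)
  have hfin : ∀ n, μ (S n) ≠ ∞ := fun n =>
    ((measure_mono inter_subset_right).trans_lt (measure_spanningSets_lt_top μ n)).ne
  have hlim : Filter.Tendsto (fun n => μ (S n)) Filter.atTop (nhds ∞) := by
    have : ⋃ n, S n = B := by rw [← inter_iUnion, iUnion_spanningSets, inter_univ]
    rw [← hμ, ← this]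
    exact tendsto_measure_iUnion_atTop fun i j hij =>
      inter_subset_inter_right _ (monotone_spanningSets μ hij)
  have hle : ∀ n, P {ω | N ω B = 0} ≤ ENNReal.ofReal (Real.exp (-(μ (S n)).toReal)) := fun n => by
    rw [← h.measure_eq_zero_of_ne_top (hS n) (hfin n)]
    exact measure_mono fun ω hω => measure_mono_null inter_subset_left hω
  have hlim' : Filter.Tendsto (fun n => (μ (S n)).toReal) Filter.atTop Filter.atTop := by
    rw [← ENNReal.tendsto_ofReal_nhds_top]
    simpa [ENNReal.ofReal_toReal (hfin _)] using hlim
  have h0 : Filter.Tendsto (fun n => ENNReal.ofReal (Real.exp (-(μ (S n)).toReal)))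
      Filter.atTop (nhds 0) := by
    rw [← ENNReal.ofReal_zero]
    exact (ENNReal.continuous_ofReal.tendsto 0).comp (Real.tendsto_exp_neg_atTop_nhds_zero.comp hlim')
  exact le_antisymm (ge_of_tendsto' h0 hle) zero_le

/-- The probability that a Poisson random measure has no mass on a set depends only on the
intensity of that set. -/
theorem measure_eq_zero_congr {Ω' X' : Type*} [MeasurableSpace Ω'] [MeasurableSpace X']
    {N' : Ω' → Measure X'} {μ' : Measure X'} {P' : Measure Ω'} {B' : Set X'} [SigmaFinite μ]
    [SigmaFinite μ'] (h : IsPoissonRandomMeasure N μ P) (h' : IsPoissonRandomMeasure N' μ' P')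
    (hB : MeasurableSet B) (hB' : MeasurableSet B') (hμ : μ B = μ' B') :
    P {ω | N ω B = 0} = P' {ω | N' ω B' = 0} := by
  by_cases ht : μ B = ∞
  · rw [h.measure_eq_zero_of_eq_top hB ht, h'.measure_eq_zero_of_eq_top hB' (hμ ▸ ht)]
  · rw [h.measure_eq_zero_of_ne_top hB ht, h'.measure_eq_zero_of_ne_top hB' (hμ ▸ ht), hμ]

theorem ae_eq_zero (h : IsPoissonRandomMeasure N μ P) [IsProbabilityMeasure P]
    (hB : MeasurableSet B) (hμ : μ B = 0) : ∀ᵐ ω ∂P, N ω B = 0 := by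
  have hm : Measurable fun ω => N ω B := (Measure.measurable_coe hB).comp h.measurable
  have := h.measure_eq_zero_of_ne_top hB (by simp [hμ])
  rw [hμ] at this
  refine (prob_compl_eq_zero_iff (s := {ω | N ω B = 0}) (hm (measurableSet_singleton 0))).2 ?_
  simpa using this

theorem ae_mem_range_natCast (h : IsPoissonRandomMeasure N μ P) (hB : MeasurableSet B)
    (hμ : μ B ≠ ∞) : ∀ᵐ ω ∂P, N ω B ∈ range ((↑) : ℕ → ℝ≥0∞) := by
  have := h.measure_preimage hB hμ (countable_range ((↑) : ℕ → ℝ≥0∞)).measurableSet.compl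
  rw [ae_iff]
  simpa using this

/-- The quadratic order is what excludes double points: a partition into k cells of intensity 1/k
has total error at most 1/k. -/
theorem measure_one_lt_le (h : IsPoissonRandomMeasure N μ P) (hB : MeasurableSet B)
    (hμ : μ B ≠ ∞) : P {ω | 1 < N ω B} ≤ μ B ^ 2 := by
  have := h.measure_preimage hB hμ (measurableSet_Ioi (a := (1 : ℝ≥0∞)))
  simp only [mem_Ioi] at this
  rw [this]
  lift μ B to ℝ≥0 using hμ with r
  have hset : {k : ℕ | (1 : ℝ≥0∞) < k} = ({0, 1} : Set ℕ)ᶜ := by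
    ext k
    simp only [mem_ofPred_eq, Nat.one_lt_cast, mem_compl_iff, mem_insert_iff, mem_singleton_iff]
    omega
  have h01 : poissonMeasure r ({0, 1} : Set ℕ) = ENNReal.ofReal ((1 + r) * Real.exp (-r)) := by
    rw [insert_eq, measure_union (by simp) (measurableSet_singleton 1), poissonMeasure_singleton,
      poissonMeasure_singleton, ← ENNReal.ofReal_add (by positivity) (by positivity)]
    congr 1
    simp
    ring
  rw [ENNReal.toNNReal_coe, hset, prob_compl_eq_one_sub .of_discrete, h01,
    ← ENNReal.ofReal_one, ← ENNReal.ofReal_sub _ (by positivity), ← ENNReal.coe_pow,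
    ← ENNReal.ofReal_coe_nnreal]
  apply ENNReal.ofReal_le_ofReal
  -- The bound follows from (1 + r) e^(-r) ≥ (1 + r)(1 - r) = 1 - r².
  have h1 := Real.one_sub_le_exp_neg (r : ℝ)
  have h2 : (0 : ℝ) ≤ r := r.2
  push_cast
  nlinarith

end IsPoissonRandomMeasure

namespace IsPoissonEnumeration

variable {Ω X : Type*} [MeasurableSpace Ω] [MeasurableSpace X]
  {ξ : ℕ → Ω → X} {μ : Measure X} {P : Measure Ω}

theorem sum_dirac_eq_zero_iff (x : ℕ → X) {B : Set X} (hB : MeasurableSet B) :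
    (Measure.sum fun ℓ => Measure.dirac (x ℓ)) B = 0 ↔ ∀ ℓ, x ℓ ∉ B := by
  simp [Measure.sum_apply _ hB, hB]

theorem measure_forall_notMem_congr {Ω' X' : Type*} [MeasurableSpace Ω'] [MeasurableSpace X']
    {ξ' : ℕ → Ω' → X'} {μ' : Measure X'} {P' : Measure Ω'} [SigmaFinite μ]
    [SigmaFinite μ'] (h : IsPoissonEnumeration ξ μ P) (h' : IsPoissonEnumeration ξ' μ' P')
    {B : Set X} {B' : Set X'} (hB : MeasurableSet B) (hB' : MeasurableSet B') (hμ : μ B = μ' B') :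
    P {ω | ∀ ℓ, ξ ℓ ω ∉ B} = P' {ω | ∀ ℓ, ξ' ℓ ω ∉ B'} := by
  simpa only [sum_dirac_eq_zero_iff _ hB, sum_dirac_eq_zero_iff _ hB'] using
    h.poisson.measure_eq_zero_congr h'.poisson hB hB' hμ

/-- A measurable null set containing the exceptions has Poisson count of mean 0, so it almost surely
contains no point. -/
theorem ae_forall [IsProbabilityMeasure P] (h : IsPoissonEnumeration ξ μ P) {p : X → Prop}
    (hp : ∀ᵐ x ∂μ, p x) : ∀ᵐ ω ∂P, ∀ ℓ, p (ξ ℓ ω) := by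
  obtain ⟨B, hpB, hB, hμB⟩ := exists_measurable_superset_of_null (ae_iff.1 hp)
  filter_upwards [h.poisson.ae_eq_zero hB hμB] with ω hω ℓ
  by_contra hc
  exact (sum_dirac_eq_zero_iff _ hB).1 hω ℓ (hpB hc)

end IsPoissonEnumeration

/-! ### The first hitting time of a Poisson process -/

/-- The first time at which the counting process of `N` reaches the level `1`. -/
noncomputable def firstHit (N : Measure ℝ) : ℝ≥0 := sInf {s : ℝ≥0 | 1 ≤ countingProcess N s}

theorem countingProcess_mono (N : Measure ℝ) : Monotone (countingProcess N) := fun s t h =>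
  measure_mono (Icc_subset_Icc_right (by exact_mod_cast h))

theorem measurable_countingProcess (s : ℝ≥0) : Measurable fun N => countingProcess N s :=
  Measure.measurable_coe measurableSet_Icc

theorem measurable_firstHit : Measurable firstHit := by
  refine measurable_of_Iio fun t => ?_
  -- The level set is upward closed, so rational times detect whether its infimum is below `t`. The
  -- first piece accounts for the default value `sInf ∅ = 0`.
  have h : firstHit ⁻¹' Iio t =
      (⋃ n : ℕ, {N | 1 ≤ countingProcess N n})ᶜ ∩ {_N | 0 < t} ∪
        ⋃ q ∈ {q : ℚ≥0 | (q : ℝ≥0) < t}, {N | 1 ≤ countingProcess N q} := by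
    ext N
    simp only [mem_preimage, mem_Iio, mem_union, mem_inter_iff, mem_compl_iff, mem_iUnion,
      mem_ofPred_eq, exists_prop]
    by_cases hN : {s : ℝ≥0 | 1 ≤ countingProcess N s}.Nonempty
    · have h1 : ∃ n : ℕ, 1 ≤ countingProcess N n := by
        obtain ⟨s, hs⟩ := hN
        obtain ⟨n, hn⟩ := exists_nat_ge s
        exact ⟨n, le_trans hs (countingProcess_mono N hn)⟩
      rw [firstHit, csInf_lt_iff (OrderBot.bddBelow _) hN]
      constructor
      · rintro ⟨s, hs, hst⟩
        obtain ⟨q, hsq, hqt⟩ := exists_rat_btwn (NNReal.coe_lt_coe.2 hst)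
        have hq : (0 : ℚ) ≤ q := by exact_mod_cast (s.2.trans hsq.le)
        lift q to ℚ≥0 using hq
        refine Or.inr ⟨q, by exact_mod_cast hqt, le_trans hs (countingProcess_mono N ?_)⟩
        exact_mod_cast hsq.le
      · rintro (⟨h, -⟩ | ⟨q, hq, h⟩)
        · exact absurd h1 h
        · exact ⟨q, h, hq⟩
    · rw [not_nonempty_iff_eq_empty] at hN
      have h2 : ∀ s, ¬ 1 ≤ countingProcess N s := fun s hs =>
        (hN ▸ hs : s ∈ (∅ : Set ℝ≥0))
      simp [firstHit, h2]
  rw [h]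
  refine ((MeasurableSet.iUnion fun n => ?_).compl.inter (.const _)).union
    (.biUnion (to_countable _) fun q _ => ?_)
  · exact measurable_countingProcess _ measurableSet_Ici
  · exact measurable_countingProcess _ measurableSet_Ici

section Deterministic

variable {N : Measure ℝ}

/-- The counting process is right-continuous, by continuity of `N` from above along shrinking
intervals of finite mass, so the infimum is attained. -/
theorem isLeast_firstHit (hfin : ∀ s, countingProcess N s ≠ ∞)
    (hex : ∃ s, 1 ≤ countingProcess N s) :
    IsLeast {s : ℝ≥0 | 1 ≤ countingProcess N s} (firstHit N) := by
  refine ⟨?_, fun s hs => csInf_le (OrderBot.bddBelow _) hs⟩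
  have hI : ⋂ n : ℕ, Icc (0 : ℝ) (firstHit N + 1 / ((n : ℝ) + 1)) = Icc 0 (firstHit N : ℝ) := by
    ext x
    simp only [mem_iInter, mem_Icc]
    refine ⟨fun h => ⟨(h 0).1, ?_⟩, fun h n => ⟨h.1, h.2.trans ?_⟩⟩
    · refine le_of_forall_pos_le_add fun ε hε => ?_
      obtain ⟨n, hn⟩ := exists_nat_one_div_lt hε
      linarith [(h n).2]
    · linarith [Nat.one_div_pos_of_nat (α := ℝ) (n := n)]
  have hcoe : ∀ n : ℕ, ((firstHit N + 1 / ((n : ℝ≥0) + 1) : ℝ≥0) : ℝ) =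
      firstHit N + 1 / ((n : ℝ) + 1) := fun n => by push_cast; rfl
  have hlim := tendsto_measure_iInter_atTop (μ := N)
    (s := fun n : ℕ => Icc (0 : ℝ) (firstHit N + 1 / ((n : ℝ) + 1)))
    (fun n => measurableSet_Icc.nullMeasurableSet)
    (fun i j hij => Icc_subset_Icc_right (by
      have := Nat.one_div_le_one_div (α := ℝ) hij
      linarith))
    ⟨0, by
      have := hfin (firstHit N + 1 / (((0 : ℕ) : ℝ≥0) + 1))
      rwa [countingProcess, hcoe] at this⟩
  rw [hI] at hlim
  refine ge_of_tendsto' hlim fun n => ?_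
  obtain ⟨s, hs, hlt⟩ := (csInf_lt_iff (OrderBot.bddBelow _) hex).1
    (show firstHit N < firstHit N + 1 / ((n : ℝ≥0) + 1) from lt_add_of_pos_right _ (by positivity))
  have := le_trans (show 1 ≤ countingProcess N s from hs) (countingProcess_mono N hlt.le)
  rwa [countingProcess, hcoe] at this

/-- Before the hitting time the count at rational times is an integer below 1, hence 0. All mass up
to the hitting time therefore sits in one atom of mass at most 1. Using rational times keeps the
almost sure integrality requirements countable. -/
theorem countingProcess_firstHit
    (hnat : ∀ q : ℚ≥0, countingProcess N q ∈ range ((↑) : ℕ → ℝ≥0∞))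
    (hsimple : ∀ s : ℝ≥0, N {(s : ℝ)} ≤ 1)
    (hleast : IsLeast {s : ℝ≥0 | 1 ≤ countingProcess N s} (firstHit N)) :
    countingProcess N (firstHit N) = 1 := by
  refine le_antisymm ?_ hleast.1
  have h0 : N (Ico 0 (firstHit N : ℝ)) = 0 := by
    have hsub : Ico 0 (firstHit N : ℝ) ⊆
        ⋃ q ∈ {q : ℚ≥0 | (q : ℝ≥0) < firstHit N}, Icc (0 : ℝ) ((q : ℝ≥0) : ℝ) := by
      intro x hx
      obtain ⟨q, hxq, hq⟩ := exists_rat_btwn hx.2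
      have hq0 : (0 : ℚ) ≤ q := by exact_mod_cast (hx.1.trans hxq.le)
      lift q to ℚ≥0 using hq0
      simp only [mem_iUnion, exists_prop]
      exact ⟨q, by change (q : ℝ≥0) < firstHit N; exact_mod_cast hq,
        hx.1, by exact_mod_cast hxq.le⟩
    refine measure_mono_null hsub ((measure_biUnion_null_iff (to_countable _)).2 fun q hq => ?_)
    obtain ⟨k, hk⟩ := hnat q
    have hlt : countingProcess N q < 1 := not_le.1 fun h => (not_le.2 hq) (hleast.2 h)
    have hk0 : k = 0 := by
      rw [← hk] at hlt
      have : k < 1 := by exact_mod_cast hlt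
      omega
    rw [← countingProcess, ← hk, hk0, Nat.cast_zero]
  calc countingProcess N (firstHit N)
      ≤ N (Ico 0 (firstHit N : ℝ)) + N {(firstHit N : ℝ)} := by
        rw [countingProcess, ← Ico_union_right (NNReal.coe_nonneg _)]
        exact measure_union_le _ _
    _ ≤ 1 := by rw [h0, zero_add]; exact hsimple _

/-- The set of times with count exactly 1 lies inside the set with count at least 1, and it contains
the least element of the larger set. Both therefore have the same least element. -/
theorem firstHitSet_eq (hleast : IsLeast {s : ℝ≥0 | 1 ≤ countingProcess N s} (firstHit N))
    (hone : countingProcess N (firstHit N) = 1) {x : ℝ≥0} (hx : x ≠ 0) :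
    firstHitSet x N = {firstHit N / x} := by
  have h : IsLeast {s : ℝ≥0 | countingProcess N s = 1} (firstHit N) :=
    ⟨hone, fun s hs => hleast.2 (le_of_eq (Eq.symm hs))⟩
  ext t
  rw [mem_singleton_iff, eq_div_iff hx, mul_comm]
  exact ⟨fun ht => IsLeast.unique ht h, fun ht => by
    rw [firstHitSet, mem_ofPred_eq, ht]; exact h⟩

end Deterministic

/-! ### Almost sure path properties and the law of the first arrival. -/

namespace IsPoissonRandomMeasure

variable {Q : Measure (Measure ℝ)}

/-- An atom of mass above 1 in `[0, n)` forces one of n(k+1) cells of length 1/(k+1) to carry mass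
above 1. By the quadratic bound this has probability at most n/(k+1), for every k. -/
theorem ae_measure_singleton_le_one (hQ : IsPoissonRandomMeasure (fun N => N) volume Q) :
    ∀ᵐ N ∂Q, ∀ s : ℝ≥0, N {(s : ℝ)} ≤ 1 := by
  have key : ∀ n : ℕ, ∀ᵐ N ∂Q, ∀ s : ℝ≥0, s < n → N {(s : ℝ)} ≤ 1 := by
    intro n
    rw [ae_iff]
    have hle : ∀ k : ℕ, Q {N | ¬ ∀ s : ℝ≥0, s < n → N {(s : ℝ)} ≤ 1} ≤
        ENNReal.ofReal (n * (1 / ((k : ℝ) + 1))) := by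
      intro k
      let B : ℕ → Set ℝ := fun i => Icc (i / ((k : ℝ) + 1)) ((i + 1) / ((k : ℝ) + 1))
      have hk : (0 : ℝ) < k + 1 := by positivity
      have hvol : ∀ i, volume (B i) = ENNReal.ofReal (1 / ((k : ℝ) + 1)) := fun i => by
        rw [Real.volume_Icc]
        congr 1
        field_simp
        ring
      have hsub : {N : Measure ℝ | ¬ ∀ s : ℝ≥0, s < n → N {(s : ℝ)} ≤ 1} ⊆
          ⋃ i ∈ Finset.range (n * (k + 1)), {N | 1 < N (B i)} := by
        intro N hN
        simp only [mem_ofPred_eq, not_forall, not_le] at hN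
        obtain ⟨s, hsn, hs⟩ := hN
        have hs0 : (0 : ℝ) ≤ s * (k + 1) := by positivity
        simp only [mem_iUnion, Finset.mem_range, exists_prop]
        refine ⟨⌊(s : ℝ) * (k + 1)⌋₊, ?_, lt_of_lt_of_le hs (measure_mono ?_)⟩
        · rw [Nat.floor_lt hs0]
          push_cast
          exact mul_lt_mul_of_pos_right (by exact_mod_cast hsn) hk
        · rw [singleton_subset_iff]
          exact ⟨(div_le_iff₀ hk).2 (Nat.floor_le hs0),
            (le_div_iff₀ hk).2 (Nat.lt_floor_add_one _).le⟩
      calc _ ≤ _ := measure_mono hsub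
        _ ≤ ∑ i ∈ Finset.range (n * (k + 1)), Q {N | 1 < N (B i)} :=
          measure_biUnion_finset_le _ _
        _ ≤ ∑ i ∈ Finset.range (n * (k + 1)), ENNReal.ofReal (1 / ((k : ℝ) + 1)) ^ 2 :=
          Finset.sum_le_sum fun i _ => by
            rw [← hvol i]
            exact hQ.measure_one_lt_le measurableSet_Icc (by rw [hvol]; exact ENNReal.ofReal_ne_top)
        _ = ENNReal.ofReal (n * (1 / ((k : ℝ) + 1))) := by
          rw [Finset.sum_const, Finset.card_range, nsmul_eq_mul,
            ← ENNReal.ofReal_pow (by positivity), ← ENNReal.ofReal_natCast,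
            ← ENNReal.ofReal_mul (by positivity)]
          congr 1
          push_cast
          field_simp
    have hlim : Filter.Tendsto (fun k : ℕ => ENNReal.ofReal (n * (1 / ((k : ℝ) + 1))))
        Filter.atTop (nhds 0) := by
      have := (tendsto_one_div_add_atTop_nhds_zero_nat (𝕜 := ℝ)).const_mul (n : ℝ)
      rw [mul_zero] at this
      rw [← ENNReal.ofReal_zero]
      exact (ENNReal.continuous_ofReal.tendsto 0).comp this
    exact le_antisymm (ge_of_tendsto' hlim hle) zero_le
  filter_upwards [ae_all_iff.2 key] with N hN s
  obtain ⟨n, hn⟩ := exists_nat_gt s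
  exact hN n s hn

theorem ae_countingProcess_mem_range (hQ : IsPoissonRandomMeasure (fun N => N) volume Q)
    (s : ℝ≥0) : ∀ᵐ N ∂Q, countingProcess N s ∈ range ((↑) : ℕ → ℝ≥0∞) :=
  hQ.ae_mem_range_natCast measurableSet_Icc (by simp)

theorem ae_countingProcess_ne_top (hQ : IsPoissonRandomMeasure (fun N => N) volume Q) :
    ∀ᵐ N ∂Q, ∀ s, countingProcess N s ≠ ∞ := by
  filter_upwards [ae_all_iff.2 fun n : ℕ => hQ.ae_countingProcess_mem_range n] with N hN s
  obtain ⟨n, hn⟩ := exists_nat_ge s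
  obtain ⟨k, hk⟩ := hN n
  refine ((countingProcess_mono N hn).trans_lt ?_).ne
  rw [← hk]
  exact ENNReal.natCast_lt_top k

/-- The half-line has infinite intensity, so it almost surely carries mass, while integer counts
that stay below 1 would all vanish. -/
theorem ae_exists_one_le (hQ : IsPoissonRandomMeasure (fun N => N) volume Q) :
    ∀ᵐ N ∂Q, ∃ s, 1 ≤ countingProcess N s := by
  have h0 : ∀ᵐ N ∂Q, N (Ici (0 : ℝ)) ≠ 0 := by
    rw [ae_iff]
    simpa using hQ.measure_eq_zero_of_eq_top measurableSet_Ici Real.volume_Ici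
  filter_upwards [h0, ae_all_iff.2 fun n : ℕ => hQ.ae_countingProcess_mem_range n] with N hN hnat
  by_contra! hc
  refine hN (measure_mono_null (t := ⋃ n : ℕ, Icc (0 : ℝ) ((n : ℝ≥0) : ℝ)) ?_
    (measure_iUnion_null fun n => ?_))
  · intro x hx
    obtain ⟨n, hn⟩ := exists_nat_ge x
    exact mem_iUnion.2 ⟨n, hx, by simpa using hn⟩
  · obtain ⟨k, hk⟩ := hnat n
    have hlt := hc n
    rw [← hk] at hlt
    have hk0 : k = 0 := by
      have : k < 1 := by exact_mod_cast hlt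
      omega
    rw [← countingProcess, ← hk, hk0, Nat.cast_zero]

theorem ae_isLeast_firstHit (hQ : IsPoissonRandomMeasure (fun N => N) volume Q) :
    ∀ᵐ N ∂Q, IsLeast {s : ℝ≥0 | 1 ≤ countingProcess N s} (firstHit N) := by
  filter_upwards [hQ.ae_countingProcess_ne_top, hQ.ae_exists_one_le] with N h1 h2
  exact isLeast_firstHit h1 h2

theorem ae_countingProcess_firstHit (hQ : IsPoissonRandomMeasure (fun N => N) volume Q) :
    ∀ᵐ N ∂Q, countingProcess N (firstHit N) = 1 := by
  filter_upwards [hQ.ae_isLeast_firstHit, hQ.ae_measure_singleton_le_one,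
    ae_all_iff.2 fun q : ℚ≥0 => hQ.ae_countingProcess_mem_range q] with N h1 h2 h3
  exact countingProcess_firstHit h3 h2 h1

variable [IsProbabilityMeasure Q]

/-- Up to a null set, arrival by time `s` is the complement of the void event on `[0, s]`. -/
theorem measure_firstHit_le (hQ : IsPoissonRandomMeasure (fun N => N) volume Q) (s : ℝ≥0) :
    Q {N | firstHit N ≤ s} = ENNReal.ofReal (1 - Real.exp (-s)) := by
  have hm : MeasurableSet {N : Measure ℝ | N (Icc 0 (s : ℝ)) = 0} :=
    Measure.measurable_coe measurableSet_Icc (measurableSet_singleton 0)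
  have hvoid := hQ.measure_eq_zero_of_ne_top (B := Icc 0 (s : ℝ)) measurableSet_Icc (by simp)
  have hae : {N | firstHit N ≤ s} =ᵐ[Q] {N : Measure ℝ | N (Icc 0 (s : ℝ)) = 0}ᶜ := by
    filter_upwards [hQ.ae_isLeast_firstHit, hQ.ae_countingProcess_mem_range s] with N h1 h2
    obtain ⟨k, hk⟩ := h2
    apply propext
    change firstHit N ≤ s ↔ ¬ countingProcess N s = 0
    have h3 : firstHit N ≤ s ↔ 1 ≤ countingProcess N s :=
      ⟨fun h => le_trans h1.1 (countingProcess_mono N h), fun h => h1.2 h⟩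
    rw [h3, ← hk]
    norm_cast
    omega
  have heq : Q {N | firstHit N ≤ s} = Q ({N : Measure ℝ | N (Icc 0 (s : ℝ)) = 0}ᶜ) :=
    measure_congr hae
  rw [heq, prob_compl_eq_one_sub hm, hvoid,
    ENNReal.ofReal_sub _ (Real.exp_nonneg _), ENNReal.ofReal_one]
  simp

/-- The first hitting time is exponentially distributed. -/
theorem map_firstHit (hQ : IsPoissonRandomMeasure (fun N => N) volume Q) :
    Q.map (fun N => (firstHit N : ℝ)) = expMeasure 1 := by
  have hm : Measurable fun N => (firstHit N : ℝ) := measurable_firstHit.coe_nnreal_real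
  have := isProbabilityMeasure_expMeasure one_pos
  have := Measure.isProbabilityMeasure_map (μ := Q) hm.aemeasurable
  refine Measure.ext_of_Iic _ _ fun a => ?_
  rw [← ofReal_cdf (expMeasure 1), cdf_expMeasure_eq one_pos, Measure.map_apply hm measurableSet_Iic]
  split_ifs with ha
  · lift a to ℝ≥0 using ha
    rw [one_mul, ← hQ.measure_firstHit_le]
    congr 1
  · have : (fun N => (firstHit N : ℝ)) ⁻¹' Iic a = ∅ := by
      ext N
      simpa using (not_le.1 ha).trans_le (firstHit N).2
    simp [this]

end IsPoissonRandomMeasure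

/-! ### Intensities -/

theorem measurableEmbedding_nnrealCoe : MeasurableEmbedding ((↑) : ℝ≥0 → ℝ) :=
  .subtype_coe measurableSet_Ici

theorem map_halfLineLebesgue :
    halfLineLebesgue.map ((↑) : ℝ≥0 → ℝ) = volume.restrict (Ici 0) := by
  rw [halfLineLebesgue, measurableEmbedding_nnrealCoe.map_comap, NNReal.range_coe]

instance : SigmaFinite halfLineLebesgue := by
  refine SigmaFinite.of_map _ measurable_coe_nnreal_real.aemeasurable ?_
  rw [map_halfLineLebesgue]
  infer_instance

instance (β : ℝ) : SigmaFinite (scaleIntensity β) := by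
  unfold scaleIntensity
  exact SigmaFinite.withDensity_ofReal _

theorem ae_scaleIntensity_ne_zero (β : ℝ) : ∀ᵐ x ∂scaleIntensity β, x ≠ 0 := by
  have h0 : halfLineLebesgue {0} = 0 := by
    rw [halfLineLebesgue, measurableEmbedding_nnrealCoe.comap_apply]
    simp
  have h1 : scaleIntensity β {0} = 0 := withDensity_absolutelyContinuous _ _ h0
  rw [ae_iff]
  simpa only [not_not, ofPred_eq_eq_singleton, ne_eq] using h1

theorem scaleIntensity_Ici {β : ℝ} (hβ₀ : 0 < β) (hβ₁ : β < 1) {a : ℝ≥0} (ha : 0 < a) :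
    scaleIntensity β (Ici a) = ENNReal.ofReal ((Real.Gamma (1 - β))⁻¹ * (a : ℝ) ^ (-β)) := by
  have hΓ : 0 < Real.Gamma (1 - β) := Real.Gamma_pos_of_pos (by linarith)
  have ha' : (0 : ℝ) < a := ha
  let g : ℝ → ℝ := fun x => (Real.Gamma (1 - β))⁻¹ * β * x ^ (-β - 1)
  have hg : Measurable fun x => ENNReal.ofReal (g x) := by fun_prop
  have hpre : Ici a = ((↑) : ℝ≥0 → ℝ) ⁻¹' Ici (a : ℝ) := by ext x; simp
  have hint : ∫ x in Ioi (a : ℝ), g x = (Real.Gamma (1 - β))⁻¹ * (a : ℝ) ^ (-β) := by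
    rw [integral_const_mul, integral_Ioi_rpow_of_lt (by linarith) ha', sub_add_cancel]
    field_simp
  calc scaleIntensity β (Ici a)
      = ∫⁻ x in ((↑) : ℝ≥0 → ℝ) ⁻¹' Ici (a : ℝ), ENNReal.ofReal (g x) ∂halfLineLebesgue := by
        rw [scaleIntensity, withDensity_apply _ measurableSet_Ici, hpre]
    _ = ∫⁻ x in Ici (a : ℝ), ENNReal.ofReal (g x) ∂(volume.restrict (Ici 0)) := by
        rw [← map_halfLineLebesgue, setLIntegral_map measurableSet_Ici hg measurable_coe_nnreal_real]
    _ = ∫⁻ x in Ioi (a : ℝ), ENNReal.ofReal (g x) := by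
        rw [Measure.restrict_restrict measurableSet_Ici,
          inter_eq_left.2 (Ici_subset_Ici.2 ha'.le), restrict_Ioi_eq_restrict_Ici]
    _ = _ := by
        rw [← hint, ofReal_integral_eq_lintegral_ofReal]
        · exact (integrableOn_Ioi_rpow_of_lt (by linarith) ha').const_mul _
        · filter_upwards [ae_restrict_mem measurableSet_Ioi] with x hx
          have : 0 < x := ha'.trans hx
          change 0 ≤ (Real.Gamma (1 - β))⁻¹ * β * x ^ (-β - 1)
          positivity

/-- This is Euler's integral at 1 - β, convergent because β < 1; it explains the normalising
constant in `scaleIntensity`. -/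
theorem lintegral_rpow_expMeasure {β : ℝ} (hβ₁ : β < 1) :
    ∫⁻ y, ENNReal.ofReal (y ^ (-β)) ∂expMeasure 1 = ENNReal.ofReal (Real.Gamma (1 - β)) := by
  have hconv := Real.GammaIntegral_convergent (s := 1 - β) (by linarith)
  calc ∫⁻ y, ENNReal.ofReal (y ^ (-β)) ∂expMeasure 1
      = ∫⁻ y, exponentialPDF 1 y * ENNReal.ofReal (y ^ (-β)) :=
        lintegral_withDensity_eq_lintegral_mul _
          (measurable_exponentialPDFReal 1).ennreal_ofReal (by fun_prop)
    _ = ∫⁻ y in Ici 0, exponentialPDF 1 y * ENNReal.ofReal (y ^ (-β)) := by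
        refine (setLIntegral_eq_of_support_subset ?_).symm
        intro y hy
        by_contra h
        exact hy (by simp only [exponentialPDF_of_neg (not_le.1 h), zero_mul])
    _ = ∫⁻ y in Ioi 0, ENNReal.ofReal (Real.exp (-y) * y ^ (1 - β - 1)) := by
        rw [← restrict_Ioi_eq_restrict_Ici]
        refine setLIntegral_congr_fun measurableSet_Ioi fun y hy => ?_
        rw [exponentialPDF_of_nonneg (le_of_lt hy), ← ENNReal.ofReal_mul (by positivity)]
        congr 1
        simp only [one_mul]
        congr 2
        ring
    _ = _ := by
        rw [Real.Gamma_eq_integral (by linarith), ofReal_integral_eq_lintegral_ofReal hconv]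
        filter_upwards [ae_restrict_mem measurableSet_Ioi] with x hx
        have : 0 < x := hx
        change 0 ≤ _
        positivity

theorem measurable_firstHit_div :
    Measurable fun p : ℝ≥0 × Measure ℝ => firstHit p.2 / p.1 :=
  (measurable_firstHit.comp measurable_snd).div measurable_fst

/-- The scaled first hitting times have intensity `d(t ^ β)`. -/
theorem map_firstHit_div_Iic {β : ℝ} (hβ₀ : 0 < β) (hβ₁ : β < 1) {Q : Measure (Measure ℝ)}
    [IsProbabilityMeasure Q] (hQ : IsPoissonRandomMeasure (fun N => N) volume Q) (t : ℝ≥0) :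
    ((scaleIntensity β).prod Q).map (fun p => firstHit p.2 / p.1) (Iic t) =
      ENNReal.ofReal ((t : ℝ) ^ β) := by
  have hΓ : 0 < Real.Gamma (1 - β) := Real.Gamma_pos_of_pos (by linarith)
  have hpos : ∀ᵐ N ∂Q, 0 < firstHit N := by
    have := hQ.measure_firstHit_le 0
    simp only [nonpos_iff_eq_zero, NNReal.coe_zero, neg_zero, Real.exp_zero, sub_self,
      ENNReal.ofReal_zero] at this
    filter_upwards [measure_eq_zero_iff_ae_notMem.1 this] with N hN
    exact pos_iff_ne_zero.2 hN
  rw [Measure.map_apply measurable_firstHit_div measurableSet_Iic,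
    Measure.prod_apply_symm (measurable_firstHit_div measurableSet_Iic)]
  rcases eq_or_ne t 0 with rfl | ht
  -- For positive τ, the inequality τ/x ≤ 0 holds only through the convention τ/0 = 0, that is, on
  -- the null set x = 0.
  · have hae : ∀ᵐ N ∂Q, scaleIntensity β ((fun x => (x, N)) ⁻¹'
        ((fun p : ℝ≥0 × Measure ℝ => firstHit p.2 / p.1) ⁻¹' Iic 0)) = 0 := by
      filter_upwards [hpos] with N hN
      refine measure_mono_null ?_ (ae_iff.1 (ae_scaleIntensity_ne_zero β))
      intro x hx
      have hx' : firstHit N / x ≤ 0 := hx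
      rw [nonpos_iff_eq_zero, div_eq_zero_iff] at hx'
      exact not_not.2 (hx'.resolve_left hN.ne')
    rw [lintegral_congr_ae hae]
    simp [Real.zero_rpow hβ₀.ne']
  · have ht0 : 0 < t := pos_iff_ne_zero.2 ht
    have ht' : (0 : ℝ) < t := ht0
    -- For fixed `N` the slice is, up to a null set, the tail `x ≥ τ/t`. Its mass separates into a
    -- constant times τ^(-β).
    have hae : ∀ᵐ N ∂Q, scaleIntensity β ((fun x => (x, N)) ⁻¹'
        ((fun p : ℝ≥0 × Measure ℝ => firstHit p.2 / p.1) ⁻¹' Iic t)) =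
        ENNReal.ofReal ((Real.Gamma (1 - β))⁻¹ * (t : ℝ) ^ β) *
          ENNReal.ofReal ((firstHit N : ℝ) ^ (-β)) := by
      filter_upwards [hpos] with N hN
      have hset : (fun x => (x, N)) ⁻¹'
          ((fun p : ℝ≥0 × Measure ℝ => firstHit p.2 / p.1) ⁻¹' Iic t) =ᵐ[scaleIntensity β]
          Ici (firstHit N / t) := by
        filter_upwards [ae_scaleIntensity_ne_zero β] with x hx
        apply propext
        change firstHit N / x ≤ t ↔ firstHit N / t ≤ x
        rw [div_le_iff₀ (pos_iff_ne_zero.2 hx), div_le_iff₀ ht0, mul_comm]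
      rw [measure_congr hset, scaleIntensity_Ici hβ₀ hβ₁ (div_pos hN ht0),
        ← ENNReal.ofReal_mul (by positivity)]
      congr 1
      have hN' : (0 : ℝ) < firstHit N := hN
      rw [NNReal.coe_div, Real.div_rpow hN'.le ht'.le, Real.rpow_neg ht'.le β]
      field_simp
    have hm : Measurable fun y : ℝ => ENNReal.ofReal (y ^ (-β)) := by fun_prop
    rw [lintegral_congr_ae hae, lintegral_const_mul _ (by
        exact hm.comp measurable_firstHit.coe_nnreal_real),
      ← lintegral_map (f := fun y : ℝ => ENNReal.ofReal (y ^ (-β))) hm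
        measurable_firstHit.coe_nnreal_real, hQ.map_firstHit,
      lintegral_rpow_expMeasure hβ₁, ← ENNReal.ofReal_mul (by positivity)]
    congr 1
    field_simp

/-- The time change of a real point, negative points being sent to `0`. -/
noncomputable def invPowTime (β : ℝ) (hβ : 0 < β) (u : ℝ) : ℝ≥0 :=
  (powTime β hβ).symm u.toNNReal

theorem measurable_invPowTime (β : ℝ) (hβ : 0 < β) : Measurable (invPowTime β hβ) :=
  (powTime β hβ).symm.continuous.measurable.comp measurable_real_toNNReal

theorem map_invPowTime_Iic {β : ℝ} (hβ : 0 < β) (t : ℝ≥0) :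
    ((volume : Measure ℝ).restrict (Ici 0)).map (invPowTime β hβ) (Iic t) =
      ENNReal.ofReal ((t : ℝ) ^ β) := by
  have hm := measurable_invPowTime β hβ
  rw [Measure.map_apply hm measurableSet_Iic, Measure.restrict_apply (hm measurableSet_Iic)]
  -- The restriction to `Ici 0` matters: negative points are all sent to 0 and would add infinite
  -- mass there.
  have : invPowTime β hβ ⁻¹' Iic t ∩ Ici 0 = Icc 0 ((t : ℝ) ^ β) := by
    ext u
    simp only [mem_inter_iff, mem_preimage, mem_Iic, mem_Ici, mem_Icc]
    rw [and_comm, and_congr_right_iff]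
    intro hu
    lift u to ℝ≥0 using hu
    rw [invPowTime, Real.toNNReal_coe]
    have h : (powTime β hβ).symm u ≤ t ↔ u ≤ t ^ β :=
      (NNReal.orderIsoRpow β hβ).symm_apply_le
    rw [h]
    norm_cast
  rw [this, Real.volume_Icc, sub_zero]

/-- Both measures give the initial interval `Iic t` the finite mass t^β, and these intervals form a
generating π-system that exhausts the half-line. -/
theorem map_firstHit_div_eq {β : ℝ} (hβ₀ : 0 < β) (hβ₁ : β < 1) {Q : Measure (Measure ℝ)}
    [IsProbabilityMeasure Q] (hQ : IsPoissonRandomMeasure (fun N => N) volume Q) :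
    ((scaleIntensity β).prod Q).map (fun p => firstHit p.2 / p.1) =
      ((volume : Measure ℝ).restrict (Ici 0)).map (invPowTime β hβ₀) := by
  refine Measure.ext_of_generateFrom_of_iUnion (range Iic) (fun n : ℕ => Iic (n : ℝ≥0))
    ((BorelSpace.measurable_eq (α := ℝ≥0)).trans (borel_eq_generateFrom_Iic ℝ≥0)) isPiSystem_Iic
    ?_ (fun n => ⟨_, rfl⟩) (fun n => ?_) ?_
  · exact iUnion_eq_univ_iff.2 fun x => exists_nat_ge x
  · rw [map_firstHit_div_Iic hβ₀ hβ₁ hQ]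
    exact ENNReal.ofReal_ne_top
  · rintro _ ⟨t, rfl⟩
    rw [map_firstHit_div_Iic hβ₀ hβ₁ hQ, map_invPowTime_Iic]

/-! ### Sup-measures of marked Poisson processes -/

namespace SupMeasure

theorem ofPoints_toFun_le_iff {α : ℝ} {Γ : ℕ → ℝ≥0} {R : ℕ → Set ℝ≥0} {G : Opens ℝ≥0} {c : ℝ≥0∞} :
    (ofPoints α Γ R).toFun G ≤ c ↔
      ∀ ℓ, (R ℓ ∩ (G : Set ℝ≥0)).Nonempty → ((Γ ℓ : ℝ≥0∞) ^ (1 / α))⁻¹ ≤ c := by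
  simp [ofPoints, iSup_le_iff]

variable {X : Type*}

/-- The sup-measure built from the images `f x = (Γ, v)` of the points `x ∈ D`. -/
noncomputable def ofMarks (α : ℝ) (D : Set X) (f : X → ℝ≥0 × ℝ≥0) (p : ℕ → X) : SupMeasure ℝ≥0 :=
  ofPoints α (fun ℓ => (f (p ℓ)).1) (fun ℓ => {t | p ℓ ∈ D ∧ t = (f (p ℓ)).2})

/-- The images of the points that push the sup-measure above the level `c` on `G` for some pair
`(G, c)` in `s`. -/
def exceedanceSet (α : ℝ) (s : Finset (Opens ℝ≥0 × ℝ≥0∞)) : Set (ℝ≥0 × ℝ≥0) :=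
  ⋃ q ∈ s, {y | y.2 ∈ q.1 ∧ q.2 < ((y.1 : ℝ≥0∞) ^ (1 / α))⁻¹}

theorem measurableSet_exceedanceSet (α : ℝ) (s : Finset (Opens ℝ≥0 × ℝ≥0∞)) :
    MeasurableSet (exceedanceSet α s) := by
  refine s.measurableSet_biUnion fun q _ => ?_
  have h1 : MeasurableSet {y : ℝ≥0 × ℝ≥0 | y.2 ∈ q.1} :=
    measurable_snd q.1.isOpen.measurableSet
  have h2 : Measurable fun y : ℝ≥0 × ℝ≥0 => ((y.1 : ℝ≥0∞) ^ (1 / α))⁻¹ := by fun_prop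
  exact h1.inter (h2 measurableSet_Ioi)

/-- This reduces finite-dimensional distribution functions to void events of the underlying point
process. -/
theorem ofMarks_toFun_le_iff {α : ℝ} {D : Set X} {f : X → ℝ≥0 × ℝ≥0} {p : ℕ → X}
    {s : Finset (Opens ℝ≥0 × ℝ≥0∞)} :
    (∀ q ∈ s, (ofMarks α D f p).toFun q.1 ≤ q.2) ↔
      ∀ ℓ, p ℓ ∉ f ⁻¹' exceedanceSet α s ∩ D := by
  have h : ∀ (G : Opens ℝ≥0) (ℓ : ℕ),
      ({t | p ℓ ∈ D ∧ t = (f (p ℓ)).2} ∩ (G : Set ℝ≥0)).Nonempty ↔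
        p ℓ ∈ D ∧ (f (p ℓ)).2 ∈ G := by
    intro G ℓ
    constructor
    · rintro ⟨_, ⟨hD, rfl⟩, hG⟩
      exact ⟨hD, hG⟩
    · rintro ⟨hD, hG⟩
      exact ⟨_, ⟨hD, rfl⟩, hG⟩
  simp only [ofMarks, ofPoints_toFun_le_iff, h, exceedanceSet, mem_inter_iff, mem_preimage,
    mem_iUnion, mem_ofPred_eq, exists_prop, not_and]
  grind

variable [MeasurableSpace X] {Ω : Type*} [MeasurableSpace Ω]

theorem measurable_ofMarks {α : ℝ} {D : Set X} (hD : MeasurableSet D) {f : X → ℝ≥0 × ℝ≥0}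
    (hf : Measurable f) {ξ : ℕ → Ω → X} (hξ : ∀ ℓ, Measurable (ξ ℓ)) :
    Measurable fun ω => ofMarks α D f fun ℓ => ξ ℓ ω := by
  refine measurable_of_toFun fun G => measurable_of_Iic fun c => ?_
  have : (fun ω => (ofMarks α D f fun ℓ => ξ ℓ ω).toFun G) ⁻¹' Iic c =
      ⋂ ℓ, (ξ ℓ ⁻¹' (f ⁻¹' exceedanceSet α {(G, c)} ∩ D))ᶜ := by
    ext ω
    have := ofMarks_toFun_le_iff (α := α) (D := D) (f := f) (p := fun ℓ => ξ ℓ ω) (s := {(G, c)})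
    simpa only [Finset.mem_singleton, forall_eq, mem_preimage, mem_Iic, mem_iInter,
      mem_compl_iff] using this
  rw [this]
  exact .iInter fun ℓ => (hξ ℓ ((hf (measurableSet_exceedanceSet _ _)).inter hD)).compl

/-- The law of the sup-measure depends only on the intensity of the images of the points. -/
theorem identDistrib_ofMarks {X' Ω' : Type*} [MeasurableSpace X'] [MeasurableSpace Ω']
    {P : Measure Ω} [IsProbabilityMeasure P] {P' : Measure Ω'} [IsProbabilityMeasure P']
    {μ : Measure X} [SigmaFinite μ] {μ' : Measure X'} [SigmaFinite μ']
    {ξ : ℕ → Ω → X} (hξ : IsPoissonEnumeration ξ μ P)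
    {ξ' : ℕ → Ω' → X'} (hξ' : IsPoissonEnumeration ξ' μ' P')
    (α : ℝ) {D : Set X} (hD : MeasurableSet D) {f : X → ℝ≥0 × ℝ≥0} (hf : Measurable f)
    {D' : Set X'} (hD' : MeasurableSet D') {f' : X' → ℝ≥0 × ℝ≥0} (hf' : Measurable f')
    (h : (μ.restrict D).map f = (μ'.restrict D').map f') :
    IdentDistrib (fun ω => ofMarks α D f fun ℓ => ξ ℓ ω)
      (fun ω => ofMarks α D' f' fun ℓ => ξ' ℓ ω) P P' := by
  have hm := measurable_ofMarks (α := α) hD hf hξ.measurable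
  have hm' := measurable_ofMarks (α := α) hD' hf' hξ'.measurable
  have := Measure.isProbabilityMeasure_map (μ := P) hm.aemeasurable
  have := Measure.isProbabilityMeasure_map (μ := P') hm'.aemeasurable
  refine ⟨hm.aemeasurable, hm'.aemeasurable, measure_ext fun s => ?_⟩
  have hE := measurableSet_exceedanceSet α s
  have hs : MeasurableSet {m : SupMeasure ℝ≥0 | ∀ q ∈ s, m.toFun q.1 ≤ q.2} :=
    measurableSet_forall_toFun_le s
  rw [Measure.map_apply hm hs, Measure.map_apply hm' hs]
  simp only [preimage_ofPred_eq, ofMarks_toFun_le_iff]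
  -- Both sides are void probabilities, so only the intensities of the two preimages need to agree.
  refine hξ.measure_forall_notMem_congr hξ' ((hf hE).inter hD) ((hf' hE).inter hD') ?_
  rw [← Measure.restrict_apply (hf hE), ← Measure.restrict_apply (hf' hE),
    ← Measure.map_apply hf hE, ← Measure.map_apply hf' hE, h]

end SupMeasure

/-! ### Reduction of both sup-measures to marked processes, and conclusion. -/

theorem map_hitMarks_eq {β : ℝ} (hβ₀ : 0 < β) (hβ₁ : β < 1) {Q : Measure (Measure ℝ)}
    [IsProbabilityMeasure Q] (hQ : IsPoissonRandomMeasure (fun N => N) volume Q) :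
    ((halfLineLebesgue.prod ((scaleIntensity β).prod Q)).restrict univ).map
        (Prod.map id fun p => firstHit p.2 / p.1) =
      ((halfLineLebesgue.prod (volume : Measure ℝ)).restrict (univ ×ˢ Ici 0)).map
        (Prod.map id (invPowTime β hβ₀)) := by
  have h := map_firstHit_div_eq hβ₀ hβ₁ hQ
  -- Pushforwards need not preserve σ-finiteness; here the sets `Iic n` have finite mass.
  have : SigmaFinite (((volume : Measure ℝ).restrict (Ici 0)).map (invPowTime β hβ₀)) := by
    refine ⟨⟨⟨fun n : ℕ => Iic (n : ℝ≥0), fun _ => trivial, fun n => ?_,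
      iUnion_eq_univ_iff.2 fun x => exists_nat_ge x⟩⟩⟩
    rw [map_invPowTime_Iic]
    exact ENNReal.ofReal_lt_top
  rw [Measure.restrict_univ, ← Measure.prod_restrict, Measure.restrict_univ,
    ← Measure.map_prod_map _ _ measurable_id measurable_firstHit_div,
    ← Measure.map_prod_map _ _ measurable_id (measurable_invPowTime β hβ₀), h]

/-- A point `U ≥ 0` lies in `T(G)` exactly when T⁻¹(U) lies in `G`. A negative `U` meets no subset
of the half-line, hence the domain `univ ×ˢ Ici 0`. -/
theorem scatteredSupMeasure_comp (α : ℝ) {β : ℝ} (hβ : 0 < β) (p : ℕ → ℝ≥0 × ℝ) :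
    (scatteredSupMeasure α p).comp (powTime β hβ) =
      SupMeasure.ofMarks α (univ ×ˢ Ici 0) (Prod.map id (invPowTime β hβ)) p := by
  have key : (fun ℓ => {t : ℝ≥0 | p ℓ ∈ (univ : Set ℝ≥0) ×ˢ Ici (0 : ℝ) ∧
      t = (Prod.map id (invPowTime β hβ) (p ℓ)).2}) =
      fun ℓ => powTime β hβ ⁻¹' {t : ℝ≥0 | (t : ℝ) = (p ℓ).2} := by
    funext ℓ
    ext t
    simp only [mem_prod, mem_univ, true_and, mem_Ici, Prod.map_snd, mem_ofPred_eq, mem_preimage]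
    constructor
    · rintro ⟨h0, rfl⟩
      rw [invPowTime, Homeomorph.apply_symm_apply, Real.coe_toNNReal _ h0]
    · intro h
      rw [← h, invPowTime, Real.toNNReal_coe, Homeomorph.symm_apply_apply]
      exact ⟨NNReal.coe_nonneg _, rfl⟩
  rw [SupMeasure.ofMarks, key]
  simp only [SupMeasure.comp, scatteredSupMeasure, SupMeasure.ofPoints, SupMeasure.mk.injEq]
  funext G
  refine iSup_congr fun ℓ => ?_
  refine iSup_congr_Prop ?_ fun _ => rfl
  change ({t : ℝ≥0 | (t : ℝ) = (p ℓ).2} ∩ powTime β hβ '' G).Nonempty ↔ _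
  rw [inter_comm, ← image_inter_preimage, image_nonempty, inter_comm]

/-- The hitting set is the singleton {τ/x} for almost every point of the intensity, hence almost
surely for all points of the process at once. -/
theorem ae_firstHitSupMeasure_eq (α β : ℝ) {Q : Measure (Measure ℝ)} [IsProbabilityMeasure Q]
    (hQ : IsPoissonRandomMeasure (fun N => N) volume Q)
    {Ω : Type*} [MeasurableSpace Ω] {P : Measure Ω} [IsProbabilityMeasure P]
    {ξ : ℕ → Ω → ℝ≥0 × ℝ≥0 × Measure ℝ}
    (hξ : IsPoissonEnumeration ξ (halfLineLebesgue.prod ((scaleIntensity β).prod Q)) P) :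
    (fun ω => SupMeasure.ofMarks α univ (Prod.map id fun p : ℝ≥0 × Measure ℝ => firstHit p.2 / p.1)
      fun ℓ => ξ ℓ ω) =ᵐ[P] fun ω => firstHitSupMeasure α fun ℓ => ξ ℓ ω := by
  have hset : ∀ᵐ p ∂(halfLineLebesgue.prod ((scaleIntensity β).prod Q)),
      firstHitSet p.2.1 p.2.2 = {firstHit p.2.2 / p.2.1} := by
    have h1 := (Measure.quasiMeasurePreserving_fst (μ := scaleIntensity β) (ν := Q)).ae
      (ae_scaleIntensity_ne_zero β)
    have h2 := (Measure.quasiMeasurePreserving_snd (μ := scaleIntensity β) (ν := Q)).ae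
      (hQ.ae_isLeast_firstHit.and hQ.ae_countingProcess_firstHit)
    refine (Measure.quasiMeasurePreserving_snd (μ := halfLineLebesgue)
      (ν := (scaleIntensity β).prod Q)).ae
      (p := fun p => firstHitSet p.1 p.2 = {firstHit p.2 / p.1}) ?_
    filter_upwards [h1, h2] with p hp1 hp2
    exact firstHitSet_eq hp2.1 hp2.2 hp1
  filter_upwards [hξ.ae_forall hset] with ω hω
  simp [SupMeasure.ofMarks, firstHitSupMeasure, hω]

theorem mainTheorem6 (α β : ℝ) (hα : 0 < α) (hβ₀ : 0 < β) (hβ₁ : β < 1)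
    -- the law of a standard Poisson random measure on the real line
    (Q : Measure (Measure ℝ)) [IsProbabilityMeasure Q]
    (hQ : IsPoissonRandomMeasure (fun N : Measure ℝ => N) volume Q)
    -- the points `(Γ_ℓ, x_ℓ, N_ℓ)` behind the first random sup-measure
    {Ω : Type*} [MeasurableSpace Ω] (P : Measure Ω) [IsProbabilityMeasure P]
    (ξ : ℕ → Ω → ℝ≥0 × ℝ≥0 × Measure ℝ)
    (hξ : IsPoissonEnumeration ξ
      (halfLineLebesgue.prod ((scaleIntensity β).prod Q)) P)
    -- the points `(Γ_ℓ, U_ℓ)` behind the second random sup-measure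
    {Ω' : Type*} [MeasurableSpace Ω'] (P' : Measure Ω') [IsProbabilityMeasure P']
    (η : ℕ → Ω' → ℝ≥0 × ℝ)
    (hη : IsPoissonEnumeration η
      (halfLineLebesgue.prod (volume : Measure ℝ)) P') :
    IdentDistrib
      (fun ω => firstHitSupMeasure α (fun ℓ => ξ ℓ ω))
      (fun ω' => (scatteredSupMeasure α (fun ℓ => η ℓ ω')).comp (powTime β hβ₀))
      P P' := by
  have h := SupMeasure.identDistrib_ofMarks hξ hη α MeasurableSet.univ
    (measurable_id.prodMap measurable_firstHit_div) (MeasurableSet.univ.prod measurableSet_Ici)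
    (measurable_id.prodMap (measurable_invPowTime β hβ₀)) (map_hitMarks_eq hβ₀ hβ₁ hQ)
  have hae := ae_firstHitSupMeasure_eq α β hQ hξ
  simp only [scatteredSupMeasure_comp]
  -- The almost sure equality carries both a.e. measurability and the law from the marked version to
  -- the original one.
  exact ⟨h.aemeasurable_fst.congr hae, h.aemeasurable_snd,
    (Measure.map_congr hae).symm.trans h.map_eq⟩
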